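/- **Theorem 4.1.** Let $A \in M_m(\mathbb{C})$ and let $h_1 < h_2 < \cdots < h_k$ be the distinct real parts of the eigenvalues of $A$. Let $A = D + N$ be the Jordan–Chevalley decomposition of $A$, that is, $D$ is diagonalizable, $N$ is nilpotent and $DN = ND$. For $1 \le j \le k$, let $F_j$ be the orthogonal projection of $\mathbb{C}^m$ (with its standard inner product) onto the subspace spanned by the eigenvectors of $D$ corresponding to eigenvalues with real part less than or equal to $h_j$, and set $F_0 := 0$. For $T \in M_m(\mathbb{C})$ write $|T| := \sqrt{T^*T}$, and let $\|\cdot\|$ be the Euclidean norm on $\mathbb{C}^m$. Then: (i) As $t \to \infty$ over the reals, $|e^{tA}|^{1/t}$ converges, and $$\lim_{t \to \infty} |e^{tA}|^{\frac{1}{t}} = \sum_{j=1}^k e^{h_j} (F_j - F_{j-1}).$$ (ii) For every $1 \le j \le k$, a non-zero vector $x \in \mathbb{C}^m$ is in $\mathrm{ran}(F_j) \setminus \mathrm{ran}(F_{j-1})$ if and only if the limit of $\|e^{tA} x\|^{1/t}$ as $t \to \infty$ over the reals exists and equals $e^{h_j}$. (iii) For every $1 \le j \le k$ and every real $s \ge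 0$, the matrix $e^{sA}$ maps the set $\mathrm{ran}(F_j) \setminus \mathrm{ran}(F_{j-1})$ into itself. -/

import Mathlib

open Filter Topology
open scoped MatrixOrder

noncomputable section

/-- `D` is diagonalizable over `ℂ`: it is similar to a diagonal matrix. -/
def IsDiagonalizableMatrix {m : ℕ} (D : Matrix (Fin m) (Fin m) ℂ) : Prop :=
  ∃ (P : Matrix (Fin m) (Fin m) ℂ) (d : Fin m → ℂ),
    IsUnit P ∧ D = P * Matrix.diagonal d * P⁻¹

/-- `A = D + N` is the Jordan-Chevalley decomposition of `A`: the matrix `D` is diagonalizable,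
`N` is nilpotent, and the two commute. Every complex square matrix `A` has exactly one such
decomposition. -/
structure IsJordanChevalley {m : ℕ} (A D N : Matrix (Fin m) (Fin m) ℂ) : Prop where
  eq_add : A = D + N
  commute : Commute D N
  diagonalizable : IsDiagonalizableMatrix D
  nilpotent : IsNilpotent N

/-- The set of real parts of the eigenvalues of `A`. -/
def eigenvalueRealParts {m : ℕ} (A : Matrix (Fin m) (Fin m) ℂ) : Set ℝ :=
  {r | ∃ μ : ℂ, Module.End.HasEigenvalue (Matrix.toEuclideanLin A) μ ∧ μ.re = r}

/-- The subspace of the Hilbert space `ℂ^m` spanned by the eigenvectors of `D` corresponding to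
eigenvalues with real part at most `r`. -/
def eigenvectorSpan {m : ℕ} (D : Matrix (Fin m) (Fin m) ℂ) (r : ℝ) :
    Submodule ℂ (EuclideanSpace ℂ (Fin m)) :=
  Submodule.span ℂ
    {v | ∃ μ : ℂ, Module.End.HasEigenvector (Matrix.toEuclideanLin D) μ v ∧ μ.re ≤ r}

/-- The matrix of the orthogonal projection of `ℂ^m` onto the subspace `V`. -/
def orthProjMatrix {m : ℕ} (V : Submodule ℂ (EuclideanSpace ℂ (Fin m))) :
    Matrix (Fin m) (Fin m) ℂ :=
  Matrix.toEuclideanLin.symm V.starProjection.toLinearMap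

/-- The projections `F 0 = 0` and, for `j = 1, …, k`, `F j` = the orthogonal projection onto the
span of the eigenvectors of `D` whose eigenvalue has real part at most the `j`-th of the numbers
`h`. The `j`-th number is `h i` with `i : Fin k` and `j = i + 1`; so `F_j` is `F i.succ` and
`F_{j-1}` is `F i.castSucc`. -/
def specProj {m k : ℕ} (D : Matrix (Fin m) (Fin m) ℂ) (h : Fin k → ℝ) :
    Fin (k + 1) → Matrix (Fin m) (Fin m) ℂ :=
  Fin.cases 0 (fun i => orthProjMatrix (eigenvectorSpan D (h i)))

/-- The range of the matrix `T` in `ℂ^m`. -/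
def matrixRan {m : ℕ} (T : Matrix (Fin m) (Fin m) ℂ) :
    Submodule ℂ (EuclideanSpace ℂ (Fin m)) :=
  LinearMap.range (Matrix.toEuclideanLin T)

/-- `|T| ^ p`, where `|T|` is the positive-semidefinite square root of `T* T`, and real powers
of a positive-semidefinite matrix are those of the functional calculus. -/
def absPow {m : ℕ} (T : Matrix (Fin m) (Fin m) ℂ) (p : ℝ) : Matrix (Fin m) (Fin m) ℂ :=
  CFC.rpow (CFC.sqrt (Matrix.conjTranspose T * T)) p

end

/-! Put `E_j = F_j - F_{j-1}` and `L_t = ∑ e^{t h_j} E_j`. The whole theorem rests on `e^{tA}` and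
`L_t` agreeing up to polynomial factors: `e^{tA} L_t⁻¹` and `L_t e^{-tA}` both have norm at most
`c(t) = C t^n` (`exists_polynomial_bounds`). The nilpotent part supplies the polynomial, since
`e^{tN}` is a finite sum. The first bound holds because `e^{tA}` grows at most like `e^{t h_j}` on
`ran F_j`. For the second, split `1 = ∑ R_j` into oblique spectral projections of `D`: `e^{-tA} R_j`
decays like `e^{-t h_j}` and lands in `ran F_j`, where `L_t` is at most of size `e^{t h_j}`.

For (i), the bounds say `c⁻² L_t² ≤ |e^{tA}|² ≤ c² L_t²`. Operator monotonicity of `x ↦ x^{1/(2t)}`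
traps `|e^{tA}|^{1/t}` between `c^{∓1/t} L_1`, and `c^{1/t} → 1` (`tendsto_abs_rpow_of_bounds`).

For (ii), the same bounds trap `‖e^{tA} x‖` on each layer (`tendsto_norm_exp_apply_rpow`). Every
nonzero vector lies in some layer and the `h_j` are distinct, so uniqueness of limits gives the
converse. For (iii), `e^{sA}` and its inverse commute with `D`, hence preserve the flag. -/

/-! ### Real combinations of orthogonal projections and the operator-order squeeze. -/

section CStar

variable {B : Type*} [CStarAlgebra B] {k : ℕ}

/-- The combination `∑ j, a j • E j` with real coefficients. -/
noncomputable def realComb (E : Fin k → B) (a : Fin k → ℝ) : B := ∑ j, a j • E j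

theorem realComb_mul {E : Fin k → B} (hE : OrthogonalIdempotents E) (a b : Fin k → ℝ) :
    realComb E a * realComb E b = realComb E (a * b) := by
  classical
  simp [realComb, Finset.sum_mul, Finset.mul_sum, hE.mul_eq, smul_smul, mul_comm]

theorem realComb_one {E : Fin k → B} (hE : CompleteOrthogonalIdempotents E) :
    realComb E 1 = 1 := by
  simp [realComb, hE.complete]

theorem realComb_isSelfAdjoint {E : Fin k → B} (hs : ∀ j, IsSelfAdjoint (E j)) (a : Fin k → ℝ) :
    IsSelfAdjoint (realComb E a) := by
  unfold realComb
  exact isSelfAdjoint_sum _ fun j _ => (IsSelfAdjoint.all (a j)).smul (hs j)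

/-- If `r` avoids all the `a j`, then `∑ (r - a j)⁻¹ • E j` inverts `r - ∑ a j • E j`. -/
theorem spectrum_realComb_subset {E : Fin k → B} (hE : CompleteOrthogonalIdempotents E)
    (a : Fin k → ℝ) : spectrum ℝ (realComb E a) ⊆ Set.range a := by
  intro r hr
  by_contra hra
  refine hr ?_
  have h0 : ∀ j, r - a j ≠ 0 := fun j hj => hra ⟨j, by linarith⟩
  have h1 : algebraMap ℝ B r - realComb E a = realComb E (fun j => r - a j) := by
    simp only [realComb, sub_smul, Finset.sum_sub_distrib, ← Finset.smul_sum, hE.complete,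
      Algebra.algebraMap_eq_smul_one]
  rw [spectrum.mem_resolventSet_iff, h1]
  refine ⟨⟨realComb E fun j => r - a j, realComb E fun j => (r - a j)⁻¹, ?_, ?_⟩, rfl⟩
  all_goals
    rw [realComb_mul hE.toOrthogonalIdempotents, ← realComb_one hE]
    congr 1
    ext j
    simp [h0 j]

theorem aeval_realComb {E : Fin k → B} (hE : CompleteOrthogonalIdempotents E) (a : Fin k → ℝ)
    (q : Polynomial ℝ) :
    Polynomial.aeval (realComb E a) q = realComb E fun j => q.eval (a j) := by
  induction q using Polynomial.induction_on' with
  | add p q hp hq =>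
    rw [map_add, hp, hq]
    simp [realComb, add_smul, Finset.sum_add_distrib]
  | monomial n c =>
    have hpow : realComb E a ^ n = realComb E (a ^ n) := by
      induction n with
      | zero => simp [realComb_one hE]
      | succ n ih => rw [pow_succ, ih, realComb_mul hE.toOrthogonalIdempotents, pow_succ]
    rw [Polynomial.aeval_monomial, hpow, ← Algebra.smul_def]
    simp [realComb, Finset.smul_sum, smul_smul]

/-- The spectrum is finite, so `f` may be replaced by a Lagrange interpolant there; this is why no
continuity of `f` is required. -/
theorem cfc_realComb {E : Fin k → B} (hE : CompleteOrthogonalIdempotents E)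
    (hs : ∀ j, IsSelfAdjoint (E j)) (a : Fin k → ℝ) (f : ℝ → ℝ) :
    cfc f (realComb E a) = realComb E fun j => f (a j) := by
  classical
  set q := Lagrange.interpolate (Finset.univ.image a) id f
  have hq : ∀ j, q.eval (a j) = f (a j) := fun j =>
    Lagrange.eval_interpolate_at_node (s := Finset.univ.image a) (v := id) f
      (Set.injOn_id _) (i := a j) (by simp)
  have h1 : cfc f (realComb E a) = cfc q.eval (realComb E a) := by
    refine cfc_congr fun r hr => ?_
    obtain ⟨j, rfl⟩ := spectrum_realComb_subset hE a hr
    exact (hq j).symm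
  rw [h1, cfc_polynomial q _ (realComb_isSelfAdjoint hs a), aeval_realComb hE]
  simp [hq]

variable [PartialOrder B] [StarOrderedRing B]

theorem realComb_nonneg {E : Fin k → B} (hE : OrthogonalIdempotents E)
    (hs : ∀ j, IsSelfAdjoint (E j)) {a : Fin k → ℝ} (ha : ∀ j, 0 ≤ a j) :
    0 ≤ realComb E a := by
  refine Finset.sum_nonneg fun j _ => smul_nonneg (ha j) ?_
  have := star_mul_self_nonneg (E j)
  rwa [(hs j).star_eq, (hE.idem j).eq] at this

theorem rpow_realComb {E : Fin k → B} (hE : CompleteOrthogonalIdempotents E)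
    (hs : ∀ j, IsSelfAdjoint (E j)) {a : Fin k → ℝ} (ha : ∀ j, 0 ≤ a j) (s : ℝ) :
    realComb E a ^ s = realComb E fun j => a j ^ s := by
  rw [CFC.rpow_eq_cfc_real (realComb_nonneg hE.toOrthogonalIdempotents hs ha),
    cfc_realComb hE hs]

/-- The norm is monotone on nonnegative elements, so `0 ≤ u - f ≤ g - f` yields `‖u - f‖ ≤ ‖g - f‖`.
-/
theorem tendsto_of_loewner_squeeze {ι : Type*} {l : Filter ι} {f g u : ι → B} {b : B}
    (hf : Tendsto f l (𝓝 b)) (hg : Tendsto g l (𝓝 b))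
    (hfu : ∀ᶠ i in l, f i ≤ u i) (hug : ∀ᶠ i in l, u i ≤ g i) : Tendsto u l (𝓝 b) := by
  have h1 : Tendsto (fun i => u i - f i) l (𝓝 0) := by
    refine squeeze_zero_norm' (a := fun i => ‖g i - f i‖) ?_ ?_
    · filter_upwards [hfu, hug] with i h1 h2
      exact CStarAlgebra.norm_le_norm_of_nonneg_of_le (sub_nonneg.2 h1) (sub_le_sub_right h2 _)
    · simpa using (hg.sub hf).norm
  simpa using h1.add hf

/-- Conjugating `X* X ≤ ‖X‖²` by `L` turns a norm bound on a quotient into an operator inequality.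
-/
theorem star_mul_self_le_of_norm_le {X L T : B} {c : ℝ} (hX : ‖X‖ ≤ c) (h : X * L = T) :
    star T * T ≤ c ^ 2 • (star L * L) := by
  have h1 : star T * T = star L * (star X * X) * L := by
    rw [← h, star_mul]; simp only [mul_assoc]
  rw [h1]
  refine (CStarAlgebra.star_left_conjugate_le_norm_smul (IsSelfAdjoint.star_mul_self X)).trans ?_
  refine smul_le_smul_of_nonneg_right ?_ (star_mul_self_nonneg L)
  rw [CStarRing.norm_star_mul_self]
  nlinarith [norm_nonneg X]

theorem sqrt_rpow_one_div {a : B} (ha : 0 ≤ a) {t : ℝ} (ht : 0 < t) :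
    CFC.sqrt a ^ (1 / t) = a ^ (1 / (2 * t)) := by
  rw [CFC.sqrt_eq_rpow, CFC.rpow_rpow_of_exponent_nonneg a _ _ (by norm_num) (by positivity) ha]
  congr 1
  field_simp

/-- If `‖T t * L₋ₜ‖` and `‖Lₜ * (T t)⁻¹‖` are bounded by `c t`, where `Lₜ = ∑ exp (t * h j) • E j`
and `c t ^ (1 / t) → 1`, then `|T t| ^ (1 / t)` converges to `∑ exp (h j) • E j`. -/
theorem tendsto_abs_rpow_of_bounds {E : Fin k → B} (hE : CompleteOrthogonalIdempotents E)
    (hs : ∀ j, IsSelfAdjoint (E j)) (h : Fin k → ℝ) {T X Y : ℝ → B} {c : ℝ → ℝ}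
    (hc : Tendsto (fun t => c t ^ (1 / t)) atTop (𝓝 1)) (hc0 : ∀ᶠ t in atTop, 0 < c t)
    (hX : ∀ᶠ t in atTop, ‖X t‖ ≤ c t) (hY : ∀ᶠ t in atTop, ‖Y t‖ ≤ c t)
    (hXT : ∀ᶠ t in atTop, X t * realComb E (fun j => Real.exp (t * h j)) = T t)
    (hYT : ∀ᶠ t in atTop, Y t * T t = realComb E (fun j => Real.exp (t * h j))) :
    Tendsto (fun t => CFC.sqrt (star (T t) * T t) ^ (1 / t)) atTop
      (𝓝 (realComb E fun j => Real.exp (h j))) := by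
  have hO := hE.toOrthogonalIdempotents
  have key : ∀ t : ℝ, star (realComb E (fun j => Real.exp (t * h j))) *
      realComb E (fun j => Real.exp (t * h j)) = realComb E (fun j => Real.exp (2 * t * h j)) := by
    intro t
    rw [(realComb_isSelfAdjoint hs _).star_eq, realComb_mul hO]
    congr 1
    ext j
    rw [Pi.mul_apply, ← Real.exp_add]
    ring_nf
  have hsm : ∀ (r : ℝ) (a : Fin k → ℝ), r • realComb E a = realComb E (fun j => r * a j) := by
    intro r a
    simp [realComb, Finset.smul_sum, smul_smul]
  have hpow : ∀ t : ℝ, 0 < t → ∀ r : ℝ, 0 < r →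
      realComb E (fun j => r ^ 2 * Real.exp (2 * t * h j)) ^ (1 / (2 * t)) =
        r ^ (1 / t) • realComb E (fun j => Real.exp (h j)) := by
    intro t ht r hr
    rw [rpow_realComb hE hs (fun j => by positivity), hsm]
    congr 1
    ext j
    rw [Real.mul_rpow (by positivity) (by positivity), ← Real.exp_mul, ← Real.rpow_natCast,
      ← Real.rpow_mul hr.le]
    congr 2 <;> push_cast <;> field_simp
  -- Real powers are operator monotone only for exponents in `[0, 1]` (Löwner–Heinz).
  have hmem : ∀ t : ℝ, 1 ≤ t → 1 / (2 * t) ∈ Set.Icc (0 : ℝ) 1 := fun t ht =>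
    ⟨by positivity, by rw [div_le_one (by positivity)]; linarith⟩
  have hinv : Tendsto (fun t => (c t)⁻¹ ^ (1 / t)) atTop (𝓝 1) := by
    have := hc.inv₀ one_ne_zero
    rw [inv_one] at this
    refine this.congr' ?_
    filter_upwards [hc0] with t ht
    rw [Real.inv_rpow ht.le]
  refine tendsto_of_loewner_squeeze
    (f := fun t => (c t)⁻¹ ^ (1 / t) • realComb E (fun j => Real.exp (h j)))
    (g := fun t => c t ^ (1 / t) • realComb E (fun j => Real.exp (h j))) ?_ ?_ ?_ ?_
  · simpa using hinv.smul_const (realComb E fun j => Real.exp (h j))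
  · simpa using hc.smul_const (realComb E fun j => Real.exp (h j))
  · filter_upwards [hc0, hY, hYT, eventually_ge_atTop 1] with t hct hYt hYTt ht
    have h1 := star_mul_self_le_of_norm_le hYt hYTt
    have h2 := smul_le_smul_of_nonneg_left h1 (by positivity : 0 ≤ ((c t)⁻¹) ^ 2)
    rw [smul_smul, ← mul_pow, inv_mul_cancel₀ hct.ne', one_pow, one_smul, key, hsm] at h2
    rw [sqrt_rpow_one_div (star_mul_self_nonneg _) (by linarith),
      ← hpow t (by linarith) _ (by positivity)]
    exact CFC.rpow_le_rpow (hmem t ht) h2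
  · filter_upwards [hc0, hX, hXT, eventually_ge_atTop 1] with t hct hXt hXTt ht
    have h1 := star_mul_self_le_of_norm_le hXt hXTt
    rw [key, hsm] at h1
    rw [sqrt_rpow_one_div (star_mul_self_nonneg _) (by linarith),
      ← hpow t (by linarith) _ hct]
    exact CFC.rpow_le_rpow (hmem t ht) h1

end CStar

/-! ### Scalar limits of `t`-th roots. -/

theorem tendsto_const_mul_pow_rpow_one_div {K : ℝ} (hK : 0 < K) (m : ℕ) :
    Tendsto (fun t : ℝ => (K * t ^ m) ^ (1 / t)) atTop (𝓝 1) := by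
  have h1 : Tendsto (fun t : ℝ => K ^ (1 / t)) atTop (𝓝 1) := by
    have := (Real.continuous_const_rpow hK.ne').tendsto 0 |>.comp
      (tendsto_const_nhds.div_atTop tendsto_id : Tendsto (fun t : ℝ => (1 : ℝ) / t) atTop (𝓝 0))
    simpa [Function.comp_def] using this
  have h2 := h1.mul (tendsto_rpow_div.pow m)
  rw [one_pow, one_mul] at h2
  refine h2.congr' ?_
  filter_upwards [eventually_gt_atTop 0] with t ht
  rw [Real.mul_rpow hK.le (by positivity), ← Real.rpow_natCast, ← Real.rpow_natCast,
    ← Real.rpow_mul ht.le, ← Real.rpow_mul ht.le, mul_comm (1 / t)]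

theorem tendsto_rpow_one_div_of_exp_bounds {f c : ℝ → ℝ} {a b h : ℝ} (ha : 0 < a) (hb : 0 < b)
    (hc : Tendsto (fun t => c t ^ (1 / t)) atTop (𝓝 1)) (hc0 : ∀ᶠ t in atTop, 0 < c t)
    (hlow : ∀ᶠ t in atTop, a * Real.exp (t * h) ≤ c t * f t)
    (hup : ∀ᶠ t in atTop, f t ≤ c t * (Real.exp (t * h) * b)) :
    Tendsto (fun t => f t ^ (1 / t)) atTop (𝓝 (Real.exp h)) := by
  have hconst : ∀ {a : ℝ}, 0 < a → Tendsto (fun t : ℝ => a ^ (1 / t)) atTop (𝓝 1) := fun ha => by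
    simpa using tendsto_const_mul_pow_rpow_one_div ha 0
  have he : ∀ t : ℝ, 0 < t → Real.exp (t * h) ^ (1 / t) = Real.exp h := fun t ht => by
    rw [← Real.exp_mul]; congr 1; field_simp
  have h1 : Tendsto (fun t => (a ^ (1 / t) * Real.exp h) / c t ^ (1 / t)) atTop
      (𝓝 (Real.exp h)) := by
    simpa [Pi.div_def] using ((hconst ha).mul_const (Real.exp h)).div hc one_ne_zero
  have h2 : Tendsto (fun t => c t ^ (1 / t) * (Real.exp h * b ^ (1 / t))) atTop
      (𝓝 (Real.exp h)) := by
    simpa using hc.mul ((hconst hb).const_mul (Real.exp h))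
  refine tendsto_of_tendsto_of_tendsto_of_le_of_le' h1 h2 ?_ ?_
  · filter_upwards [hc0, hlow, eventually_gt_atTop 0] with t hct hl ht
    rw [← he t ht, ← Real.mul_rpow ha.le (by positivity),
      ← Real.div_rpow (by positivity) hct.le]
    refine Real.rpow_le_rpow (by positivity) ?_ (by positivity)
    rw [div_le_iff₀ hct]; linarith
  · filter_upwards [hc0, hlow, hup, eventually_gt_atTop 0] with t hct hl hu ht
    -- Nonnegativity of `f` is not assumed; the lower bound and `0 < c t` force it.
    have hf : 0 ≤ f t := by
      have : 0 < c t * f t := lt_of_lt_of_le (by positivity) hl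
      exact (pos_of_mul_pos_right this hct.le).le
    rw [← he t ht, ← Real.mul_rpow (by positivity) hb.le,
      ← Real.mul_rpow hct.le (by positivity)]
    exact Real.rpow_le_rpow hf hu (by positivity)

/-! ### Successive differences of a chain of idempotents. -/

section Filtration

theorem completeOrthogonalIdempotents_sub {R : Type*} [Ring R] {k : ℕ} {F : Fin (k + 1) → R}
    (h0 : F 0 = 0) (h1 : F (Fin.last k) = 1)
    (hl : ∀ i j, i ≤ j → F i * F j = F i) (hr : ∀ i j, i ≤ j → F j * F i = F i) :
    CompleteOrthogonalIdempotents fun j : Fin k => F j.succ - F j.castSucc where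
  idem j := by
    have h := (Fin.castSucc_lt_succ (i := j)).le
    simp only [IsIdempotentElem, sub_mul, mul_sub, hl _ _ le_rfl, hl _ _ h, hr _ _ h]
    abel
  ortho i j hij := by
    rcases lt_or_gt_of_ne hij with h | h
    · have h1 : i.succ ≤ j.castSucc := Fin.succ_le_castSucc_iff.2 h
      have h2 := (Fin.castSucc_lt_succ (i := j)).le
      have h3 := (Fin.castSucc_lt_succ (i := i)).le
      simp only [sub_mul, mul_sub, hl _ _ h1, hl _ _ (h1.trans h2), hl _ _ (h3.trans h1),
        hl _ _ (h3.trans (h1.trans h2))]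
      abel
    · have h1 : j.succ ≤ i.castSucc := Fin.succ_le_castSucc_iff.2 h
      have h2 := (Fin.castSucc_lt_succ (i := j)).le
      have h3 := (Fin.castSucc_lt_succ (i := i)).le
      simp only [sub_mul, mul_sub, hr _ _ h1, hr _ _ (h1.trans h3), hr _ _ (h2.trans h1),
        hr _ _ (h2.trans (h1.trans h3))]
      abel
  complete := by
    have : ∀ n (G : Fin (n + 1) → R), ∑ j : Fin n, (G j.succ - G j.castSucc) =
        G (Fin.last n) - G 0 := by
      intro n
      induction n with
      | zero => intro G; simp
      | succ n ih =>
        intro G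
        rw [Fin.sum_univ_castSucc]
        have := ih fun i => G i.castSucc
        simp only [Fin.castSucc_zero] at this
        simp only [Fin.succ_castSucc, this, Fin.succ_last]
        abel
    rw [this, h0, h1, sub_zero]

end Filtration

/-! ### Matrices of orthogonal projections. -/

section Proj

variable {m : ℕ}

theorem orthProjMatrix_eq_symm (V : Submodule ℂ (EuclideanSpace ℂ (Fin m))) :
    orthProjMatrix V = (Matrix.toEuclideanCLM (n := Fin m) (𝕜 := ℂ)).symm V.starProjection := rfl

theorem toEuclideanLin_orthProjMatrix (V : Submodule ℂ (EuclideanSpace ℂ (Fin m)))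
    (x : EuclideanSpace ℂ (Fin m)) :
    Matrix.toEuclideanLin (orthProjMatrix V) x = V.starProjection x := by
  simp [orthProjMatrix]

theorem toEuclideanLin_mul_apply (S T : Matrix (Fin m) (Fin m) ℂ)
    (x : EuclideanSpace ℂ (Fin m)) :
    Matrix.toEuclideanLin (S * T) x = Matrix.toEuclideanLin S (Matrix.toEuclideanLin T x) := by
  simp [Matrix.toLpLin_apply, Matrix.mulVec_mulVec]

theorem toEuclideanLin_one_apply (x : EuclideanSpace ℂ (Fin m)) :
    Matrix.toEuclideanLin (1 : Matrix (Fin m) (Fin m) ℂ) x = x := by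
  simp

theorem matrixRan_orthProjMatrix (V : Submodule ℂ (EuclideanSpace ℂ (Fin m))) :
    matrixRan (orthProjMatrix V) = V := by
  ext x
  constructor
  · rintro ⟨y, rfl⟩
    rw [toEuclideanLin_orthProjMatrix]
    exact Submodule.starProjection_apply_mem _ _
  · intro hx
    exact ⟨x, by rw [toEuclideanLin_orthProjMatrix, Submodule.starProjection_eq_self_iff.2 hx]⟩

theorem orthProjMatrix_mul_of_mem {V : Submodule ℂ (EuclideanSpace ℂ (Fin m))}
    {M : Matrix (Fin m) (Fin m) ℂ} (h : ∀ x, Matrix.toEuclideanLin M x ∈ V) :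
    orthProjMatrix V * M = M := by
  apply Matrix.toEuclideanLin.injective
  ext1 x
  rw [toEuclideanLin_mul_apply, toEuclideanLin_orthProjMatrix,
    Submodule.starProjection_eq_self_iff.2 (h x)]

theorem mul_orthProjMatrix_of_fixes {V : Submodule ℂ (EuclideanSpace ℂ (Fin m))}
    {M : Matrix (Fin m) (Fin m) ℂ} (h : ∀ x ∈ V, Matrix.toEuclideanLin M x = x) :
    M * orthProjMatrix V = orthProjMatrix V := by
  apply Matrix.toEuclideanLin.injective
  ext1 x
  rw [toEuclideanLin_mul_apply, toEuclideanLin_orthProjMatrix,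
    h _ (Submodule.starProjection_apply_mem _ _)]

theorem orthProjMatrix_isSelfAdjoint (V : Submodule ℂ (EuclideanSpace ℂ (Fin m))) :
    IsSelfAdjoint (orthProjMatrix V) := by
  have h : (Matrix.toEuclideanLin (orthProjMatrix V)).IsSymmetric := by
    rw [orthProjMatrix, LinearEquiv.apply_symm_apply]
    exact Submodule.starProjection_isSymmetric V
  exact Matrix.isSymmetric_toEuclideanLin_iff.1 h

theorem orthProjMatrix_mul_of_ge {V W : Submodule ℂ (EuclideanSpace ℂ (Fin m))} (h : V ≤ W) :
    orthProjMatrix W * orthProjMatrix V = orthProjMatrix V :=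
  orthProjMatrix_mul_of_mem fun x => by
    rw [toEuclideanLin_orthProjMatrix]
    exact h (Submodule.starProjection_apply_mem _ _)

theorem orthProjMatrix_mul_of_le {V W : Submodule ℂ (EuclideanSpace ℂ (Fin m))} (h : V ≤ W) :
    orthProjMatrix V * orthProjMatrix W = orthProjMatrix V := by
  have := congrArg star (orthProjMatrix_mul_of_ge h)
  rwa [star_mul, (orthProjMatrix_isSelfAdjoint V).star_eq,
    (orthProjMatrix_isSelfAdjoint W).star_eq] at this

theorem orthProjMatrix_bot :
    orthProjMatrix (⊥ : Submodule ℂ (EuclideanSpace ℂ (Fin m))) = 0 := by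
  simp [orthProjMatrix]

theorem orthProjMatrix_top :
    orthProjMatrix (⊤ : Submodule ℂ (EuclideanSpace ℂ (Fin m))) = 1 := by
  simp [orthProjMatrix_eq_symm, Submodule.starProjection_top']

end Proj

/-! ### Functional calculus of a diagonalizable matrix, and its nilpotent perturbations. -/

section DiagCalc

open scoped Matrix.Norms.L2Operator

variable {m : ℕ}

/-- The matrix acting as multiplication by `f i` on the `i`-th column of `P`. -/
noncomputable def diagConj (P : Matrix (Fin m) (Fin m) ℂ) (f : Fin m → ℂ) :
    Matrix (Fin m) (Fin m) ℂ := P * Matrix.diagonal f * P⁻¹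

variable {P : Matrix (Fin m) (Fin m) ℂ}

theorem diagConj_mul (hP : IsUnit P) (f g : Fin m → ℂ) :
    diagConj P f * diagConj P g = diagConj P (f * g) := by
  have h : P⁻¹ * P = 1 := Matrix.nonsing_inv_mul P ((Matrix.isUnit_iff_isUnit_det P).1 hP)
  calc diagConj P f * diagConj P g
      = P * Matrix.diagonal f * (P⁻¹ * P) * Matrix.diagonal g * P⁻¹ := by
        simp only [diagConj, mul_assoc]
    _ = diagConj P (f * g) := by
        rw [h, mul_one, diagConj, mul_assoc P, Matrix.diagonal_mul_diagonal]; rfl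

theorem diagConj_one (hP : IsUnit P) : diagConj P 1 = 1 := by
  have h : P * P⁻¹ = 1 := Matrix.mul_nonsing_inv P ((Matrix.isUnit_iff_isUnit_det P).1 hP)
  rw [diagConj, Matrix.diagonal_one', mul_one, h]

theorem diagConj_sum {ι : Type*} (s : Finset ι) (f : ι → Fin m → ℂ) :
    ∑ i ∈ s, diagConj P (f i) = diagConj P (∑ i ∈ s, f i) := by
  have : Matrix.diagonal (∑ i ∈ s, f i) = ∑ i ∈ s, Matrix.diagonal (f i) :=
    map_sum (Matrix.diagonalAddMonoidHom (Fin m) ℂ) f s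
  simp only [diagConj, this, Finset.mul_sum, Finset.sum_mul]

theorem norm_diagConj_le {f : Fin m → ℂ} {b : ℝ} (hb : 0 ≤ b) (hf : ∀ i, ‖f i‖ ≤ b) :
    ‖diagConj P f‖ ≤ ‖P‖ * ‖P⁻¹‖ * b := by
  have h1 : ‖(Matrix.diagonal f : Matrix (Fin m) (Fin m) ℂ)‖ ≤ b := by
    rw [Matrix.l2_opNorm_diagonal]
    exact (pi_norm_le_iff_of_nonneg hb).2 hf
  calc ‖diagConj P f‖ ≤ ‖P‖ * ‖(Matrix.diagonal f : Matrix (Fin m) (Fin m) ℂ)‖ * ‖P⁻¹‖ :=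
        (norm_mul_le _ _).trans (by gcongr; exact norm_mul_le _ _)
    _ ≤ ‖P‖ * b * ‖P⁻¹‖ := by gcongr
    _ = _ := by ring

theorem exp_smul_diagConj (hP : IsUnit P) (d : Fin m → ℂ) (t : ℝ) :
    NormedSpace.exp (t • diagConj P d) = diagConj P fun i => Complex.exp (t * d i) := by
  have h1 : t • diagConj P d = P * Matrix.diagonal (t • d) * P⁻¹ := by
    simp [diagConj, Matrix.diagonal_smul]
  rw [h1, Matrix.exp_conj _ _ hP, Matrix.exp_diagonal, diagConj]
  congr 3
  ext i
  rw [Pi.coe_exp, Complex.exp_eq_exp_ℂ]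
  simp

/-- In the basis of columns of `P`, commuting with `diagonal d` means that the `(i, j)` entry
vanishes unless `d i = d j`, and then `g (d i) = g (d j)` as well. -/
theorem commute_diagConj_comp (hP : IsUnit P) {d : Fin m → ℂ} {M : Matrix (Fin m) (Fin m) ℂ}
    (hM : Commute (diagConj P d) M) (g : ℂ → ℂ) : Commute (diagConj P (g ∘ d)) M := by
  have h : P⁻¹ * P = 1 := Matrix.nonsing_inv_mul P ((Matrix.isUnit_iff_isUnit_det P).1 hP)
  have h' : P * P⁻¹ = 1 := Matrix.mul_nonsing_inv P ((Matrix.isUnit_iff_isUnit_det P).1 hP)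
  have hl : ∀ f, P⁻¹ * (diagConj P f * M) * P = Matrix.diagonal f * (P⁻¹ * M * P) := fun f => by
    calc P⁻¹ * (diagConj P f * M) * P = (P⁻¹ * P) * Matrix.diagonal f * (P⁻¹ * M * P) := by
          simp only [diagConj, mul_assoc]
      _ = _ := by rw [h, one_mul]
  have hr : ∀ f, P⁻¹ * (M * diagConj P f) * P = (P⁻¹ * M * P) * Matrix.diagonal f := fun f => by
    calc P⁻¹ * (M * diagConj P f) * P = (P⁻¹ * M * P) * Matrix.diagonal f * (P⁻¹ * P) := by
          simp only [diagConj, mul_assoc]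
      _ = _ := by rw [h, mul_one]
  have hinj : ∀ X Y : Matrix (Fin m) (Fin m) ℂ, P⁻¹ * X * P = P⁻¹ * Y * P → X = Y := by
    intro X Y hXY
    have hid : ∀ Z : Matrix (Fin m) (Fin m) ℂ, P * (P⁻¹ * Z * P) * P⁻¹ = Z := fun Z => by
      calc P * (P⁻¹ * Z * P) * P⁻¹ = (P * P⁻¹) * Z * (P * P⁻¹) := by simp only [mul_assoc]
        _ = Z := by rw [h', one_mul, mul_one]
    rw [← hid X, hXY, hid]
  apply hinj
  rw [hl, hr]
  have hd := congrArg (fun X => P⁻¹ * X * P) hM.eq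
  simp only [hl, hr] at hd
  ext i j
  have hij := congrFun (congrFun hd i) j
  rw [Matrix.diagonal_mul, Matrix.mul_diagonal] at hij ⊢
  by_cases h0 : (P⁻¹ * M * P) i j = 0
  · simp [h0]
  · have : d i = d j := mul_right_cancel₀ h0 (hij.trans (mul_comm _ _))
    simp only [Function.comp_apply, this, mul_comm]

/-- An eigenvector has nonzero `P`-coordinates only where `d i = μ`. This is needed because
`eigenvectorSpan` is built from all eigenvectors, not only from the columns of `P`. -/
theorem diagConj_comp_apply_of_eigenvector (hP : IsUnit P) {d : Fin m → ℂ} {μ : ℂ}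
    {v : EuclideanSpace ℂ (Fin m)} (hv : Matrix.toEuclideanLin (diagConj P d) v = μ • v)
    (g : ℂ → ℂ) : Matrix.toEuclideanLin (diagConj P (g ∘ d)) v = g μ • v := by
  have h : P⁻¹ * P = 1 := Matrix.nonsing_inv_mul P ((Matrix.isUnit_iff_isUnit_det P).1 hP)
  have h' : P * P⁻¹ = 1 := Matrix.mul_nonsing_inv P ((Matrix.isUnit_iff_isUnit_det P).1 hP)
  set c := Matrix.toEuclideanLin P⁻¹ v with hc
  have hvc : v = Matrix.toEuclideanLin P c := by
    rw [hc, ← toEuclideanLin_mul_apply, h', toEuclideanLin_one_apply]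
  have h1 : ∀ f, Matrix.toEuclideanLin (diagConj P f) v =
      Matrix.toEuclideanLin P (Matrix.toEuclideanLin (Matrix.diagonal f) c) := fun f => by
    rw [diagConj, toEuclideanLin_mul_apply, toEuclideanLin_mul_apply]
  have h2 : Matrix.toEuclideanLin (Matrix.diagonal d) c = μ • c := by
    have := congrArg (Matrix.toEuclideanLin P⁻¹) hv
    rwa [h1, ← toEuclideanLin_mul_apply, h, toEuclideanLin_one_apply, map_smul] at this
  have h3 : Matrix.toEuclideanLin (Matrix.diagonal (g ∘ d)) c = g μ • c := by
    ext i
    have hi := congrArg (fun x : EuclideanSpace ℂ (Fin m) => x i) h2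
    simp only [Matrix.toLpLin_apply, Matrix.mulVec_diagonal, PiLp.smul_apply,
      smul_eq_mul] at hi
    simp only [Matrix.toLpLin_apply, Matrix.mulVec_diagonal, PiLp.smul_apply,
      smul_eq_mul, Function.comp_apply]
    by_cases h0 : c i = 0
    · simp [h0]
    · rw [mul_right_cancel₀ h0 hi]
  rw [h1, h3, map_smul, ← hvc]

/-- The `i`-th column of `P`. -/
noncomputable def colVec (P : Matrix (Fin m) (Fin m) ℂ) (i : Fin m) : EuclideanSpace ℂ (Fin m) :=
  Matrix.toEuclideanLin P (EuclideanSpace.single i 1)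

theorem colVec_ne_zero (hP : IsUnit P) (i : Fin m) : colVec P i ≠ 0 := by
  have h : P⁻¹ * P = 1 := Matrix.nonsing_inv_mul P ((Matrix.isUnit_iff_isUnit_det P).1 hP)
  intro h0
  have := congrArg (Matrix.toEuclideanLin P⁻¹) h0
  rw [colVec, ← toEuclideanLin_mul_apply, h, toEuclideanLin_one_apply, map_zero] at this
  simpa using congrArg (fun x : EuclideanSpace ℂ (Fin m) => x i) this

theorem toEuclideanLin_diagConj_apply (f : Fin m → ℂ) (x : EuclideanSpace ℂ (Fin m)) :
    Matrix.toEuclideanLin (diagConj P f) x =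
      ∑ i, (f i * Matrix.toEuclideanLin P⁻¹ x i) • colVec P i := by
  rw [diagConj, toEuclideanLin_mul_apply, toEuclideanLin_mul_apply]
  set c := Matrix.toEuclideanLin P⁻¹ x
  have : Matrix.toEuclideanLin (Matrix.diagonal f) c =
      ∑ i, (f i * c i) • EuclideanSpace.single i (1 : ℂ) := by
    ext j
    simp [Matrix.toLpLin_apply, Matrix.mulVec_diagonal, Pi.single_apply]
  rw [this, map_sum]
  simp [colVec]

theorem diagConj_colVec (hP : IsUnit P) (f : Fin m → ℂ) (i : Fin m) :
    Matrix.toEuclideanLin (diagConj P f) (colVec P i) = f i • colVec P i := by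
  have h : P⁻¹ * P = 1 := Matrix.nonsing_inv_mul P ((Matrix.isUnit_iff_isUnit_det P).1 hP)
  rw [toEuclideanLin_diagConj_apply]
  conv_lhs => enter [2, j]; rw [colVec, ← toEuclideanLin_mul_apply, h, toEuclideanLin_one_apply]
  simp [colVec]

theorem hasEigenvector_colVec (hP : IsUnit P) (d : Fin m → ℂ) (i : Fin m) :
    Module.End.HasEigenvector (Matrix.toEuclideanLin (diagConj P d)) (d i) (colVec P i) :=
  ⟨Module.End.mem_eigenspace_iff.2 (diagConj_colVec hP d i), colVec_ne_zero hP i⟩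

/-- The spectral projection, along the other eigenspaces, onto the sum of the eigenspaces of
`diagConj P d` whose eigenvalue has real part at most `r`. -/
noncomputable def specLE (P : Matrix (Fin m) (Fin m) ℂ) (d : Fin m → ℂ) (r : ℝ) :
    Matrix (Fin m) (Fin m) ℂ :=
  diagConj P ((fun z : ℂ => if z.re ≤ r then 1 else 0) ∘ d)

theorem specLE_apply_mem (hP : IsUnit P) (d : Fin m → ℂ) (r : ℝ)
    (x : EuclideanSpace ℂ (Fin m)) :
    Matrix.toEuclideanLin (specLE P d r) x ∈ eigenvectorSpan (diagConj P d) r := by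
  rw [specLE, toEuclideanLin_diagConj_apply]
  refine Submodule.sum_mem _ fun i _ => ?_
  by_cases hi : (d i).re ≤ r
  · exact Submodule.smul_mem _ _ (Submodule.subset_span ⟨d i, hasEigenvector_colVec hP d i, hi⟩)
  · simp [hi]

/-- Together with `specLE_apply_mem`, this says that the oblique projection has the same range as
the orthogonal one. The oblique one is useful because it commutes with everything that commutes with
`D`, which the orthogonal one need not. -/
theorem specLE_apply_of_mem (hP : IsUnit P) (d : Fin m → ℂ) (r : ℝ)
    {x : EuclideanSpace ℂ (Fin m)} (hx : x ∈ eigenvectorSpan (diagConj P d) r) :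
    Matrix.toEuclideanLin (specLE P d r) x = x := by
  induction hx using Submodule.span_induction with
  | mem v hv =>
    obtain ⟨μ, hμ, hr⟩ := hv
    rw [specLE, diagConj_comp_apply_of_eigenvector hP hμ.apply_eq_smul]
    simp [hr]
  | zero => simp
  | add x y _ _ hx hy => rw [map_add, hx, hy]
  | smul a x _ hx => rw [map_smul, hx]

theorem eigenvectorSpan_mono (D : Matrix (Fin m) (Fin m) ℂ) : Monotone (eigenvectorSpan D) :=
  fun _ _ h => Submodule.span_mono fun _ ⟨μ, hv, hμ⟩ => ⟨μ, hv, hμ.trans h⟩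

theorem apply_mem_eigenvectorSpan_of_commute {D M : Matrix (Fin m) (Fin m) ℂ} (h : Commute D M)
    {r : ℝ} {x : EuclideanSpace ℂ (Fin m)} (hx : x ∈ eigenvectorSpan D r) :
    Matrix.toEuclideanLin M x ∈ eigenvectorSpan D r := by
  induction hx using Submodule.span_induction with
  | mem v hv =>
    obtain ⟨μ, hμ, hr⟩ := hv
    by_cases h0 : Matrix.toEuclideanLin M v = 0
    · rw [h0]; exact Submodule.zero_mem _
    · refine Submodule.subset_span ⟨μ, ⟨Module.End.mem_eigenspace_iff.2 ?_, h0⟩, hr⟩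
      rw [← toEuclideanLin_mul_apply, h.eq, toEuclideanLin_mul_apply, hμ.apply_eq_smul, map_smul]
  | zero => simp
  | add x y _ _ hx hy => rw [map_add]; exact Submodule.add_mem _ hx hy
  | smul a x _ hx => rw [map_smul]; exact Submodule.smul_mem _ _ hx

/-- For an eigenvector `v` of `D`, the last nonzero `N ^ l v` is killed by `N` and still satisfies
the eigenvector equation of `D`. This makes `h`, defined through `A`, list the real parts of the `d
i`. -/
theorem hasEigenvalue_add_of_commute_nilpotent {D N : Matrix (Fin m) (Fin m) ℂ}
    (h : Commute D N) (hN : IsNilpotent N) {μ : ℂ}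
    (hμ : Module.End.HasEigenvalue (Matrix.toEuclideanLin D) μ) :
    Module.End.HasEigenvalue (Matrix.toEuclideanLin (D + N)) μ := by
  classical
  obtain ⟨v, hv⟩ := hμ.exists_hasEigenvector
  obtain ⟨n, hn⟩ := hN
  have hex : ∃ n, Matrix.toEuclideanLin (N ^ n) v = 0 := ⟨n, by simp [hn]⟩
  have hspec := Nat.find_spec hex
  obtain ⟨l, hl⟩ : ∃ l, Nat.find hex = l + 1 := by
    refine Nat.exists_eq_succ_of_ne_zero fun h0 => hv.2 ?_
    rwa [h0, pow_zero, toEuclideanLin_one_apply] at hspec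
  have hmin : Matrix.toEuclideanLin (N ^ l) v ≠ 0 := Nat.find_min hex (by omega)
  refine Module.End.hasEigenvalue_of_hasEigenvector
    (x := Matrix.toEuclideanLin (N ^ l) v) ⟨Module.End.mem_eigenspace_iff.2 ?_, hmin⟩
  rw [hl, pow_succ', toEuclideanLin_mul_apply] at hspec
  rw [map_add, LinearMap.add_apply, hspec, add_zero, ← toEuclideanLin_mul_apply,
    (h.pow_right l).eq, toEuclideanLin_mul_apply, hv.apply_eq_smul, map_smul]

/-- The exponential series stops at the nilpotency exponent. Both signs of `t` are covered because
`e^{-tN}` is estimated too. -/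
theorem exists_norm_exp_smul_le_of_nilpotent {N : Matrix (Fin m) (Fin m) ℂ}
    (hN : IsNilpotent N) :
    ∃ (K : ℝ) (n : ℕ), 0 < K ∧ ∀ t : ℝ, 1 ≤ |t| → ‖NormedSpace.exp (t • N)‖ ≤ K * |t| ^ n := by
  obtain ⟨n, hn⟩ := hN
  refine ⟨(∑ i ∈ Finset.range n, ‖N ^ i‖) + 1, n, by positivity, fun t ht => ?_⟩
  have h0 : ∀ i ∉ Finset.range n, ((i.factorial : ℝ)⁻¹) • (t • N) ^ i = 0 := fun i hi => by
    rw [smul_pow, pow_eq_zero_of_le (by simpa using hi) hn]; simp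
  rw [NormedSpace.exp_eq_tsum ℝ]
  simp only
  rw [tsum_eq_sum h0]
  calc ‖∑ i ∈ Finset.range n, ((i.factorial : ℝ)⁻¹) • (t • N) ^ i‖
      ≤ ∑ i ∈ Finset.range n, ‖N ^ i‖ * |t| ^ n := by
        refine norm_sum_le_of_le _ fun i hi => ?_
        rw [smul_pow, norm_smul, norm_smul, norm_pow, norm_inv, Real.norm_eq_abs t]
        have h1 : ‖(i.factorial : ℝ)‖⁻¹ ≤ 1 := by
          refine inv_le_one_of_one_le₀ ?_
          simpa using Nat.one_le_iff_ne_zero.2 (Nat.factorial_ne_zero i)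
        have h2 : |t| ^ i ≤ |t| ^ n := pow_le_pow_right₀ ht (Finset.mem_range.1 hi).le
        calc ‖(i.factorial : ℝ)‖⁻¹ * (|t| ^ i * ‖N ^ i‖) ≤ 1 * (|t| ^ n * ‖N ^ i‖) := by gcongr
          _ = _ := by ring
    _ ≤ _ := by
        rw [← Finset.sum_mul]
        gcongr
        linarith

end DiagCalc

/-! ### The flag of spectral subspaces and its orthogonal layers. -/

section Flag

variable {m k : ℕ}

/-- The flag of subspaces onto which the matrices `specProj D h i` project. -/
noncomputable def specSpace (D : Matrix (Fin m) (Fin m) ℂ) (h : Fin k → ℝ) :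
    Fin (k + 1) → Submodule ℂ (EuclideanSpace ℂ (Fin m)) :=
  Fin.cases ⊥ fun i => eigenvectorSpan D (h i)

theorem specProj_eq_orthProjMatrix (D : Matrix (Fin m) (Fin m) ℂ) (h : Fin k → ℝ)
    (i : Fin (k + 1)) : specProj D h i = orthProjMatrix (specSpace D h i) := by
  cases i using Fin.cases with
  | zero => exact orthProjMatrix_bot.symm
  | succ i => rfl

theorem matrixRan_specProj (D : Matrix (Fin m) (Fin m) ℂ) (h : Fin k → ℝ) (i : Fin (k + 1)) :
    matrixRan (specProj D h i) = specSpace D h i := by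
  rw [specProj_eq_orthProjMatrix, matrixRan_orthProjMatrix]

theorem specSpace_mono (D : Matrix (Fin m) (Fin m) ℂ) {h : Fin k → ℝ} (hh : Monotone h) :
    Monotone (specSpace D h) := by
  intro i j hij
  cases i using Fin.cases with
  | zero => exact bot_le
  | succ i =>
    cases j using Fin.cases with
    | zero => exact absurd hij (by simp)
    | succ j => exact eigenvectorSpan_mono D (hh (Fin.succ_le_succ_iff.1 hij))

theorem apply_mem_specSpace_of_commute {D M : Matrix (Fin m) (Fin m) ℂ} (hc : Commute D M)
    (h : Fin k → ℝ) {i : Fin (k + 1)} {x : EuclideanSpace ℂ (Fin m)} (hx : x ∈ specSpace D h i) :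
    Matrix.toEuclideanLin M x ∈ specSpace D h i := by
  cases i using Fin.cases with
  | zero =>
    have : x = 0 := hx
    rw [this, map_zero]
    exact Submodule.zero_mem _
  | succ i => exact apply_mem_eigenvectorSpan_of_commute hc hx

theorem specSpace_last {P : Matrix (Fin m) (Fin m) ℂ} (hP : IsUnit P) {d : Fin m → ℂ}
    {h : Fin k → ℝ} (hh : Monotone h) (hd : ∀ i, ∃ j, h j = (d i).re) :
    specSpace (diagConj P d) h (Fin.last k) = ⊤ := by
  refine eq_top_iff.2 fun x _ => ?_
  have hx := toEuclideanLin_diagConj_apply (P := P) 1 x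
  rw [diagConj_one hP, toEuclideanLin_one_apply] at hx
  rw [hx]
  refine Submodule.sum_mem _ fun i _ => Submodule.smul_mem _ _ ?_
  obtain ⟨j, hj⟩ := hd i
  refine specSpace_mono _ hh (Fin.le_last j.succ) ?_
  exact Submodule.subset_span ⟨d i, hasEigenvector_colVec hP d i, hj.ge⟩

/-- The orthogonal projection onto the `j`-th layer of the flag. -/
noncomputable def layerProj (D : Matrix (Fin m) (Fin m) ℂ) (h : Fin k → ℝ) (j : Fin k) :
    Matrix (Fin m) (Fin m) ℂ := specProj D h j.succ - specProj D h j.castSucc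

theorem specProj_mul_of_le (D : Matrix (Fin m) (Fin m) ℂ) {h : Fin k → ℝ} (hh : Monotone h)
    {i j : Fin (k + 1)} (hij : i ≤ j) : specProj D h i * specProj D h j = specProj D h i := by
  simp only [specProj_eq_orthProjMatrix]
  exact orthProjMatrix_mul_of_le (specSpace_mono D hh hij)

theorem specProj_mul_of_ge (D : Matrix (Fin m) (Fin m) ℂ) {h : Fin k → ℝ} (hh : Monotone h)
    {i j : Fin (k + 1)} (hij : i ≤ j) : specProj D h j * specProj D h i = specProj D h i := by
  simp only [specProj_eq_orthProjMatrix]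
  exact orthProjMatrix_mul_of_ge (specSpace_mono D hh hij)

theorem layerProj_complete {P : Matrix (Fin m) (Fin m) ℂ} (hP : IsUnit P) {d : Fin m → ℂ}
    {h : Fin k → ℝ} (hh : Monotone h) (hd : ∀ i, ∃ j, h j = (d i).re) :
    CompleteOrthogonalIdempotents (layerProj (diagConj P d) h) :=
  completeOrthogonalIdempotents_sub (F := specProj (diagConj P d) h) rfl
    (by rw [specProj_eq_orthProjMatrix, specSpace_last hP hh hd, orthProjMatrix_top])
    (fun _ _ hij => specProj_mul_of_le _ hh hij) (fun _ _ hij => specProj_mul_of_ge _ hh hij)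

theorem layerProj_isSelfAdjoint (D : Matrix (Fin m) (Fin m) ℂ) (h : Fin k → ℝ) (j : Fin k) :
    IsSelfAdjoint (layerProj D h j) := by
  simp only [layerProj, specProj_eq_orthProjMatrix]
  exact (orthProjMatrix_isSelfAdjoint _).sub (orthProjMatrix_isSelfAdjoint _)

theorem specProj_mul_layerProj (D : Matrix (Fin m) (Fin m) ℂ) {h : Fin k → ℝ} (hh : Monotone h)
    (j : Fin k) : specProj D h j.succ * layerProj D h j = layerProj D h j := by
  rw [layerProj, mul_sub, specProj_mul_of_ge D hh le_rfl,
    specProj_mul_of_ge D hh (Fin.castSucc_lt_succ (i := j)).le]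

theorem layerProj_mul_specProj_of_le (D : Matrix (Fin m) (Fin m) ℂ) {h : Fin k → ℝ}
    (hh : Monotone h) {i j : Fin k} (hij : i ≤ j) :
    layerProj D h i * specProj D h j.succ = layerProj D h i := by
  have h1 : i.succ ≤ j.succ := Fin.succ_le_succ_iff.2 hij
  rw [layerProj, sub_mul, specProj_mul_of_le D hh h1,
    specProj_mul_of_le D hh ((Fin.castSucc_lt_succ (i := i)).le.trans h1)]

theorem layerProj_mul_specProj_of_lt (D : Matrix (Fin m) (Fin m) ℂ) {h : Fin k → ℝ}
    (hh : Monotone h) {i j : Fin k} (hij : j < i) :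
    layerProj D h i * specProj D h j.succ = 0 := by
  have h1 : j.succ ≤ i.castSucc := Fin.succ_le_castSucc_iff.2 hij
  rw [layerProj, sub_mul, specProj_mul_of_ge D hh h1,
    specProj_mul_of_ge D hh (h1.trans (Fin.castSucc_lt_succ (i := i)).le), sub_self]

/-- The flag climbs from `⊥`, which misses `x`, to `⊤`, so `x` must enter at some step. -/
theorem exists_mem_layer {P : Matrix (Fin m) (Fin m) ℂ} (hP : IsUnit P) {d : Fin m → ℂ}
    {h : Fin k → ℝ} (hh : Monotone h) (hd : ∀ i, ∃ j, h j = (d i).re)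
    {x : EuclideanSpace ℂ (Fin m)} (hx : x ≠ 0) :
    ∃ j : Fin k, x ∈ specSpace (diagConj P d) h j.succ ∧
      x ∉ specSpace (diagConj P d) h j.castSucc := by
  by_contra! hcon
  have hall : ∀ i, x ∉ specSpace (diagConj P d) h i := by
    intro i
    induction i using Fin.induction with
    | zero => exact hx
    | succ i ih => exact fun hi => ih (hcon i hi)
  exact hall (Fin.last k) (by rw [specSpace_last hP hh hd]; trivial)

end Flag

/-! ### Comparison of `e^{tA}` with `L_t` up to polynomial factors. -/

section Bounds

open scoped Matrix.Norms.L2Operator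

variable {m k : ℕ}

theorem norm_toEuclideanLin_le (M : Matrix (Fin m) (Fin m) ℂ) (x : EuclideanSpace ℂ (Fin m)) :
    ‖Matrix.toEuclideanLin M x‖ ≤ ‖M‖ * ‖x‖ :=
  Matrix.l2_opNorm_mulVec M x

theorem norm_orthProjMatrix_le (V : Submodule ℂ (EuclideanSpace ℂ (Fin m))) :
    ‖orthProjMatrix V‖ ≤ 1 := by
  rw [Matrix.cstar_norm_def, orthProjMatrix_eq_symm, StarAlgEquiv.apply_symm_apply]
  exact Submodule.starProjection_norm_le V

theorem exp_smul_add {D N : Matrix (Fin m) (Fin m) ℂ} (hc : Commute D N) (t : ℝ) :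
    NormedSpace.exp (t • (D + N)) = NormedSpace.exp (t • N) * NormedSpace.exp (t • D) := by
  rw [add_comm, smul_add]
  exact Matrix.exp_add_of_commute _ _ ((hc.symm.smul_left t).smul_right t)

theorem exp_neg_smul_mul_exp_smul (A : Matrix (Fin m) (Fin m) ℂ) (t : ℝ) :
    NormedSpace.exp ((-t) • A) * NormedSpace.exp (t • A) = 1 := by
  rw [← Matrix.exp_add_of_commute _ _ (((Commute.refl A).smul_left _).smul_right _), ← add_smul]
  simp

/-- The oblique projection `specLE` fixes the range of `F_j`, so it can be inserted before it;
`e^{tD}` times `specLE` is then diagonal in the basis `P`, with entries at most `e^{t h_j}` in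
modulus. -/
theorem norm_exp_mul_specProj_le {P N : Matrix (Fin m) (Fin m) ℂ} (hP : IsUnit P)
    {d : Fin m → ℂ} (hc : Commute (diagConj P d) N) (h : Fin k → ℝ) {t : ℝ} (ht : 0 ≤ t)
    (j : Fin k) :
    ‖NormedSpace.exp (t • (diagConj P d + N)) * specProj (diagConj P d) h j.succ‖ ≤
      ‖NormedSpace.exp (t • N)‖ * (‖P‖ * ‖P⁻¹‖ * Real.exp (t * h j)) := by
  have h1 : specLE P d (h j) * specProj (diagConj P d) h j.succ =
      specProj (diagConj P d) h j.succ :=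
    mul_orthProjMatrix_of_fixes fun x hx => specLE_apply_of_mem hP d _ hx
  have h2 : NormedSpace.exp (t • (diagConj P d + N)) * specProj (diagConj P d) h j.succ =
      NormedSpace.exp (t • N) * (NormedSpace.exp (t • diagConj P d) * specLE P d (h j)) *
        specProj (diagConj P d) h j.succ := by
    conv_lhs => rw [← h1, exp_smul_add hc]
    simp only [mul_assoc]
  have h3 : ‖NormedSpace.exp (t • diagConj P d) * specLE P d (h j)‖ ≤
      ‖P‖ * ‖P⁻¹‖ * Real.exp (t * h j) := by
    rw [exp_smul_diagConj hP, specLE, diagConj_mul hP]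
    refine norm_diagConj_le (Real.exp_pos _).le fun i => ?_
    simp only [Pi.mul_apply, Function.comp_apply]
    split_ifs with hi
    · rw [mul_one, Complex.norm_exp]
      simpa using mul_le_mul_of_nonneg_left hi ht
    · simpa using (Real.exp_pos _).le
  have h4 : ‖specProj (diagConj P d) h j.succ‖ ≤ 1 := norm_orthProjMatrix_le _
  rw [h2]
  calc _ ≤ ‖NormedSpace.exp (t • N)‖ *
        ‖NormedSpace.exp (t • diagConj P d) * specLE P d (h j)‖ *
          ‖specProj (diagConj P d) h j.succ‖ :=
        (norm_mul_le _ _).trans (by gcongr; exact norm_mul_le _ _)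
    _ ≤ ‖NormedSpace.exp (t • N)‖ * (‖P‖ * ‖P⁻¹‖ * Real.exp (t * h j)) * 1 := by gcongr
    _ = _ := mul_one _

theorem norm_exp_mul_realComb_le {P N : Matrix (Fin m) (Fin m) ℂ} (hP : IsUnit P)
    {d : Fin m → ℂ} (hc : Commute (diagConj P d) N) {h : Fin k → ℝ} (hh : Monotone h) {t : ℝ}
    (ht : 0 ≤ t) :
    ‖NormedSpace.exp (t • (diagConj P d + N)) *
        realComb (layerProj (diagConj P d) h) fun j => Real.exp (-(t * h j))‖ ≤
      ‖NormedSpace.exp (t • N)‖ *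
        (‖P‖ * ‖P⁻¹‖ * ∑ j, ‖layerProj (diagConj P d) h j‖) := by
  rw [realComb, Finset.mul_sum, Finset.mul_sum, Finset.mul_sum]
  refine norm_sum_le_of_le _ fun j _ => ?_
  -- Inserting `F_j` also alters the layer norm on the right-hand side; the final rewrite restores
  -- it.
  rw [mul_smul_comm, norm_smul, ← specProj_mul_layerProj _ hh, ← mul_assoc, Real.norm_eq_abs,
    Real.abs_exp, specProj_mul_layerProj _ hh]
  calc Real.exp (-(t * h j)) * ‖NormedSpace.exp (t • (diagConj P d + N)) *
          specProj (diagConj P d) h j.succ * layerProj (diagConj P d) h j‖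
      ≤ Real.exp (-(t * h j)) * (‖NormedSpace.exp (t • N)‖ *
          (‖P‖ * ‖P⁻¹‖ * Real.exp (t * h j)) * ‖layerProj (diagConj P d) h j‖) := by
        gcongr
        refine (norm_mul_le _ _).trans ?_
        gcongr
        exact norm_exp_mul_specProj_le hP hc h ht j
    _ = (Real.exp (-(t * h j)) * Real.exp (t * h j)) * (‖NormedSpace.exp (t • N)‖ *
          (‖P‖ * ‖P⁻¹‖ * ‖layerProj (diagConj P d) h j‖)) := by ring
    _ = _ := by rw [← Real.exp_add, neg_add_cancel, Real.exp_zero, one_mul]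

/-- Only the layers `i ≤ j` survive on the range of `F_j`, and there `h i ≤ h j`. -/
theorem norm_realComb_mul_specProj_le (D : Matrix (Fin m) (Fin m) ℂ) {h : Fin k → ℝ}
    (hh : Monotone h) {t : ℝ} (ht : 0 ≤ t) (j : Fin k) :
    ‖realComb (layerProj D h) (fun i => Real.exp (t * h i)) * specProj D h j.succ‖ ≤
      Real.exp (t * h j) * ∑ i, ‖layerProj D h i‖ := by
  rw [realComb, Finset.sum_mul, Finset.mul_sum]
  refine norm_sum_le_of_le _ fun i _ => ?_
  rw [smul_mul_assoc]
  rcases le_or_gt i j with hij | hij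
  · rw [layerProj_mul_specProj_of_le D hh hij, norm_smul, Real.norm_eq_abs, Real.abs_exp]
    have := hh hij
    gcongr
  · rw [layerProj_mul_specProj_of_lt D hh hij, smul_zero, norm_zero]
    positivity

/-- Orthogonal layers do not suit `e^{-tA}`: on `ran F_j` it can be as large as the smallest `h_i`
allows. The oblique `R j` isolate one real part, and the growth of `L_t` on `ran F_j` cancels the
decay of `e^{-tA} R j`. The factor `k` counts the summands. -/
theorem norm_realComb_mul_exp_neg_le {P N : Matrix (Fin m) (Fin m) ℂ} (hP : IsUnit P)
    {d : Fin m → ℂ} (hc : Commute (diagConj P d) N) {h : Fin k → ℝ} (hh : StrictMono h)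
    (hd : ∀ i, ∃ j, h j = (d i).re) {t : ℝ} (ht : 0 ≤ t) :
    ‖realComb (layerProj (diagConj P d) h) (fun j => Real.exp (t * h j)) *
        NormedSpace.exp ((-t) • (diagConj P d + N))‖ ≤
      ‖NormedSpace.exp ((-t) • N)‖ *
        (k * (‖P‖ * ‖P⁻¹‖ * ∑ j, ‖layerProj (diagConj P d) h j‖)) := by
  set D := diagConj P d with hD
  set L := realComb (layerProj D h) (fun j => Real.exp (t * h j))
  -- `R j` is the spectral projection onto the eigenspaces of `D` with real part `h j`.
  let R : Fin k → Matrix (Fin m) (Fin m) ℂ := fun j =>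
    diagConj P ((fun z : ℂ => if z.re = h j then 1 else 0) ∘ d)
  have hR : ∑ j, R j = 1 := by
    rw [diagConj_sum, ← diagConj_one hP]
    congr 1
    ext i
    obtain ⟨j, hj⟩ := hd i
    simp [Finset.sum_apply, ← hj, hh.injective.eq_iff]
  have hQR : ∀ j, specLE P d (h j) * R j = R j := by
    intro j
    rw [specLE, diagConj_mul hP]
    congr 1
    ext i
    simp only [Pi.mul_apply, Function.comp_apply]
    split_ifs with h1 h2 <;> simp_all
  have hFQ : ∀ j, specProj D h j.succ * specLE P d (h j) = specLE P d (h j) := fun j =>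
    orthProjMatrix_mul_of_mem fun x => specLE_apply_mem hP d _ x
  have hQN : ∀ j, Commute (specLE P d (h j)) (NormedSpace.exp ((-t) • N)) := fun j =>
    ((commute_diagConj_comp hP hc _).smul_right (-t)).exp_right
  have hQD : ∀ j, Commute (specLE P d (h j)) (NormedSpace.exp ((-t) • D)) := fun j =>
    ((commute_diagConj_comp hP (Commute.refl _) _).smul_right (-t)).exp_right
  -- `e^{-tA} R j` lands in `ran F_j`: `specLE` is absorbed by `R j` after commuting past both
  -- exponentials, and `F_j` fixes its range.
  have hF : ∀ j, specProj D h j.succ *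
      (NormedSpace.exp ((-t) • N) * (NormedSpace.exp ((-t) • D) * R j)) =
      NormedSpace.exp ((-t) • N) * (NormedSpace.exp ((-t) • D) * R j) := by
    intro j
    have hQ : specLE P d (h j) *
        (NormedSpace.exp ((-t) • N) * (NormedSpace.exp ((-t) • D) * R j)) =
        NormedSpace.exp ((-t) • N) * (NormedSpace.exp ((-t) • D) * R j) := by
      rw [← mul_assoc, (hQN j).eq, mul_assoc, ← mul_assoc (specLE P d (h j)), (hQD j).eq,
        mul_assoc (NormedSpace.exp ((-t) • D)), hQR]
    rw [← hQ, ← mul_assoc, hFQ]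
  have hdec : L * NormedSpace.exp ((-t) • (D + N)) = ∑ j, (L * specProj D h j.succ) *
      (NormedSpace.exp ((-t) • N) * (NormedSpace.exp ((-t) • D) * R j)) := by
    rw [← mul_one (L * _), ← hR, Finset.mul_sum]
    refine Finset.sum_congr rfl fun j _ => ?_
    rw [mul_assoc L (specProj D h j.succ), hF, exp_smul_add hc]
    simp only [mul_assoc]
  have hRn : ∀ j, ‖NormedSpace.exp ((-t) • D) * R j‖ ≤
      ‖P‖ * ‖P⁻¹‖ * Real.exp (-(t * h j)) := by
    intro j
    rw [hD, exp_smul_diagConj hP, diagConj_mul hP]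
    refine norm_diagConj_le (Real.exp_pos _).le fun i => ?_
    simp only [Pi.mul_apply, Function.comp_apply]
    split_ifs with hi
    · rw [mul_one, Complex.norm_exp]
      simp [hi]
    · simpa using (Real.exp_pos _).le
  rw [hdec]
  calc _ ≤ ∑ j : Fin k, ‖NormedSpace.exp ((-t) • N)‖ *
          (‖P‖ * ‖P⁻¹‖ * ∑ j, ‖layerProj D h j‖) := by
        refine norm_sum_le_of_le _ fun j _ => ?_
        calc _ ≤ ‖L * specProj D h j.succ‖ * (‖NormedSpace.exp ((-t) • N)‖ *
                ‖NormedSpace.exp ((-t) • D) * R j‖) :=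
              (norm_mul_le _ _).trans (by gcongr; exact norm_mul_le _ _)
          _ ≤ (Real.exp (t * h j) * ∑ i, ‖layerProj D h i‖) * (‖NormedSpace.exp ((-t) • N)‖ *
                (‖P‖ * ‖P⁻¹‖ * Real.exp (-(t * h j)))) := by
              gcongr
              · exact norm_realComb_mul_specProj_le D hh.monotone ht j
              · exact hRn j
          _ = (Real.exp (t * h j) * Real.exp (-(t * h j))) * (‖NormedSpace.exp ((-t) • N)‖ *
                (‖P‖ * ‖P⁻¹‖ * ∑ i, ‖layerProj D h i‖)) := by ring
          _ = _ := by rw [← Real.exp_add, add_neg_cancel, Real.exp_zero, one_mul]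
    _ = _ := by
        rw [Finset.sum_const, Finset.card_univ, Fintype.card_fin, nsmul_eq_mul]
        ring

/-- Uniform polynomial bounds comparing `exp (t • A)` with `∑ exp (t * h j) • layerProj D h j`. -/
theorem exists_polynomial_bounds {P N : Matrix (Fin m) (Fin m) ℂ} (hP : IsUnit P)
    {d : Fin m → ℂ} (hc : Commute (diagConj P d) N) (hN : IsNilpotent N) {h : Fin k → ℝ}
    (hh : StrictMono h) (hd : ∀ i, ∃ j, h j = (d i).re) :
    ∃ (C : ℝ) (n : ℕ), 0 < C ∧ ∀ t : ℝ, 1 ≤ t →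
      (∀ j : Fin k, ‖NormedSpace.exp (t • (diagConj P d + N)) *
        specProj (diagConj P d) h j.succ‖ ≤ C * t ^ n * Real.exp (t * h j)) ∧
      ‖NormedSpace.exp (t • (diagConj P d + N)) *
        realComb (layerProj (diagConj P d) h) fun j => Real.exp (-(t * h j))‖ ≤ C * t ^ n ∧
      ‖realComb (layerProj (diagConj P d) h) (fun j => Real.exp (t * h j)) *
        NormedSpace.exp ((-t) • (diagConj P d + N))‖ ≤ C * t ^ n := by
  obtain ⟨K, n, hK, hexp⟩ := exists_norm_exp_smul_le_of_nilpotent hN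
  set κ := ‖P‖ * ‖P⁻¹‖ with hκ
  set S := ∑ j, ‖layerProj (diagConj P d) h j‖ with hS
  have hκ0 : 0 ≤ κ := by positivity
  have hS0 : 0 ≤ S := by positivity
  -- One constant dominates the three separate ones; the final `1` keeps it positive.
  refine ⟨K * (κ + κ * S + k * (κ * S) + 1), n, by positivity, fun t ht => ?_⟩
  have ht0 : 0 ≤ t := zero_le_one.trans ht
  have hb : ∀ s : ℝ, |s| = t → ∀ b : ℝ, 0 ≤ b → b ≤ κ + κ * S + k * (κ * S) + 1 →
      ‖NormedSpace.exp (s • N)‖ * b ≤ K * (κ + κ * S + k * (κ * S) + 1) * t ^ n := by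
    intro s hs b hb0 hb1
    have h1 := hexp s (hs ▸ ht)
    rw [hs] at h1
    calc _ ≤ (K * t ^ n) * (κ + κ * S + k * (κ * S) + 1) := by gcongr
      _ = _ := by ring
  have h1 : 0 ≤ κ * S := by positivity
  have h2 : 0 ≤ k * (κ * S) := by positivity
  refine ⟨fun j => ?_, ?_, ?_⟩
  · refine (norm_exp_mul_specProj_le hP hc h ht0 j).trans ?_
    rw [← mul_assoc]
    exact mul_le_mul_of_nonneg_right (hb t (abs_of_nonneg ht0) _ hκ0 (by linarith))
      (Real.exp_pos _).le
  · exact (norm_exp_mul_realComb_le hP hc hh.monotone ht0).trans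
      (hb t (abs_of_nonneg ht0) _ h1 (by linarith))
  · exact (norm_realComb_mul_exp_neg_le hP hc hh hd ht0).trans
      (hb (-t) (by rw [abs_neg, abs_of_nonneg ht0]) _ h2 (by linarith))

end Bounds

/-! ### The limits of `|e^{tA}|^{1/t}` and `‖e^{tA} x‖^{1/t}`. -/

section Limits

open scoped Matrix.Norms.L2Operator

variable {m k : ℕ}

theorem commute_exp_smul {D A : Matrix (Fin m) (Fin m) ℂ} (hc : Commute D A) (t : ℝ) :
    Commute D (NormedSpace.exp (t • A)) :=
  (hc.smul_right t).exp_right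

theorem tendsto_absPow_exp {P N : Matrix (Fin m) (Fin m) ℂ} (hP : IsUnit P)
    {d : Fin m → ℂ} (hc : Commute (diagConj P d) N) (hN : IsNilpotent N) {h : Fin k → ℝ}
    (hh : StrictMono h) (hd : ∀ i, ∃ j, h j = (d i).re) :
    Tendsto (fun t : ℝ => absPow (NormedSpace.exp (t • (diagConj P d + N))) (1 / t)) atTop
      (𝓝 (realComb (layerProj (diagConj P d) h) fun j => Real.exp (h j))) := by
  obtain ⟨C, n, hC, hb⟩ := exists_polynomial_bounds hP hc hN hh hd
  have hE := layerProj_complete hP hh.monotone hd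
  refine tendsto_abs_rpow_of_bounds hE (layerProj_isSelfAdjoint _ h) h
    (X := fun t => NormedSpace.exp (t • (diagConj P d + N)) *
      realComb (layerProj (diagConj P d) h) fun j => Real.exp (-(t * h j)))
    (Y := fun t => realComb (layerProj (diagConj P d) h) (fun j => Real.exp (t * h j)) *
      NormedSpace.exp ((-t) • (diagConj P d + N)))
    (tendsto_const_mul_pow_rpow_one_div hC n) ?_ ?_ ?_ ?_ ?_
  · filter_upwards [eventually_gt_atTop 0] with t ht
    positivity
  · filter_upwards [eventually_ge_atTop 1] with t ht using (hb t ht).2.1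
  · filter_upwards [eventually_ge_atTop 1] with t ht using (hb t ht).2.2
  · refine Eventually.of_forall fun t => ?_
    rw [mul_assoc, realComb_mul hE.toOrthogonalIdempotents]
    have : ((fun j => Real.exp (-(t * h j))) * fun j => Real.exp (t * h j)) = 1 := by
      ext j
      simp [← Real.exp_add]
    rw [this, realComb_one hE, mul_one]
  · refine Eventually.of_forall fun t => ?_
    rw [mul_assoc, exp_neg_smul_mul_exp_smul, mul_one]

/-- The upper bound is that of `e^{tA} F_j`. For the lower one, `E_j L_t x = e^{t h_j} E_j x` with
`E_j x ≠ 0`, while `‖L_t x‖ ≤ c(t) ‖e^{tA} x‖`. -/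
theorem tendsto_norm_exp_apply_rpow {P N : Matrix (Fin m) (Fin m) ℂ} (hP : IsUnit P)
    {d : Fin m → ℂ} (hc : Commute (diagConj P d) N) (hN : IsNilpotent N) {h : Fin k → ℝ}
    (hh : StrictMono h) (hd : ∀ i, ∃ j, h j = (d i).re) {j : Fin k}
    {x : EuclideanSpace ℂ (Fin m)} (hx : x ∈ specSpace (diagConj P d) h j.succ)
    (hx' : x ∉ specSpace (diagConj P d) h j.castSucc) :
    Tendsto (fun t : ℝ => ‖Matrix.toEuclideanLin
      (NormedSpace.exp (t • (diagConj P d + N))) x‖ ^ (1 / t)) atTop (𝓝 (Real.exp (h j))) := by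
  obtain ⟨C, n, hC, hb⟩ := exists_polynomial_bounds hP hc hN hh hd
  set A := diagConj P d + N
  set E := layerProj (diagConj P d) h with hE'
  have hE : CompleteOrthogonalIdempotents E := layerProj_complete hP hh.monotone hd
  have hfix : Matrix.toEuclideanLin (specProj (diagConj P d) h j.succ) x = x := by
    rw [specProj_eq_orthProjMatrix, toEuclideanLin_orthProjMatrix]
    exact Submodule.starProjection_eq_self_iff.2 hx
  -- Otherwise `x = F_j x = F_{j-1} x` would lie in the lower step of the flag.
  have hEx : Matrix.toEuclideanLin (E j) x ≠ 0 := by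
    intro h0
    refine hx' ?_
    rw [hE', layerProj, map_sub, LinearMap.sub_apply, hfix, sub_eq_zero,
      specProj_eq_orthProjMatrix, toEuclideanLin_orthProjMatrix] at h0
    rw [h0]
    exact Submodule.starProjection_apply_mem _ _
  have hx0 : x ≠ 0 := fun h0 => hEx (by rw [h0, map_zero])
  have hEj : 0 < ‖E j‖ := norm_pos_iff.2 fun h0 => hEx (by rw [h0, map_zero, LinearMap.zero_apply])
  refine tendsto_rpow_one_div_of_exp_bounds
    (a := ‖Matrix.toEuclideanLin (E j) x‖ / ‖E j‖) (b := ‖x‖)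
    (div_pos (norm_pos_iff.2 hEx) hEj) (norm_pos_iff.2 hx0)
    (tendsto_const_mul_pow_rpow_one_div hC n) ?_ ?_ ?_
  · filter_upwards [eventually_gt_atTop 0] with t ht
    positivity
  · filter_upwards [eventually_ge_atTop 1] with t ht
    set L := realComb E (fun j => Real.exp (t * h j)) with hL
    have h1 : Matrix.toEuclideanLin L x = Matrix.toEuclideanLin
        (L * NormedSpace.exp ((-t) • A)) (Matrix.toEuclideanLin (NormedSpace.exp (t • A)) x) := by
      rw [← toEuclideanLin_mul_apply, mul_assoc, exp_neg_smul_mul_exp_smul, mul_one]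
    have h2 : E j * L = Real.exp (t * h j) • E j := by
      classical
      simp [hL, realComb, Finset.mul_sum, hE.toOrthogonalIdempotents.mul_eq]
    have h3 : Matrix.toEuclideanLin (E j) (Matrix.toEuclideanLin L x) =
        Real.exp (t * h j) • Matrix.toEuclideanLin (E j) x := by
      rw [← toEuclideanLin_mul_apply, h2, ← Complex.coe_smul, map_smul, LinearMap.smul_apply,
        Complex.coe_smul]
    have h4 := congrArg norm h3
    rw [norm_smul, Real.norm_eq_abs, Real.abs_exp] at h4
    have h5 : ‖Matrix.toEuclideanLin L x‖ ≤ C * t ^ n *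
        ‖Matrix.toEuclideanLin (NormedSpace.exp (t • A)) x‖ := by
      rw [h1]
      refine (norm_toEuclideanLin_le _ _).trans ?_
      gcongr
      exact (hb t ht).2.2
    rw [div_mul_eq_mul_div, div_le_iff₀ hEj, mul_comm, ← h4, mul_comm _ ‖E j‖]
    exact (norm_toEuclideanLin_le _ _).trans (by gcongr)
  · filter_upwards [eventually_ge_atTop 1] with t ht
    conv_lhs => rw [← hfix, ← toEuclideanLin_mul_apply]
    refine (norm_toEuclideanLin_le _ _).trans ?_
    rw [← mul_assoc]
    gcongr
    exact (hb t ht).1 j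

end Limits

theorem theorem4p1 {m k : ℕ} (A D N : Matrix (Fin m) (Fin m) ℂ)
    (hJC : IsJordanChevalley A D N)
    (h : Fin k → ℝ) (h_mono : StrictMono h) (h_range : Set.range h = eigenvalueRealParts A) :
    Tendsto (fun t : ℝ => absPow (NormedSpace.exp (t • A)) (1 / t)) atTop
      (𝓝 (∑ j : Fin k, Real.exp (h j) • (specProj D h j.succ - specProj D h j.castSucc))) ∧
    (∀ (j : Fin k) (x : EuclideanSpace ℂ (Fin m)), x ≠ 0 →
      (x ∈ (matrixRan (specProj D h j.succ) : Set (EuclideanSpace ℂ (Fin m))) \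
          matrixRan (specProj D h j.castSucc) ↔
        Tendsto (fun t : ℝ => ‖Matrix.toEuclideanLin (NormedSpace.exp (t • A)) x‖ ^ (1 / t)) atTop
          (𝓝 (Real.exp (h j))))) ∧
    (∀ (j : Fin k) (s : ℝ), 0 ≤ s →
      Set.MapsTo (fun x => Matrix.toEuclideanLin (NormedSpace.exp (s • A)) x)
        ((matrixRan (specProj D h j.succ) : Set (EuclideanSpace ℂ (Fin m))) \
          matrixRan (specProj D h j.castSucc))
        ((matrixRan (specProj D h j.succ) : Set (EuclideanSpace ℂ (Fin m))) \
          matrixRan (specProj D h j.castSucc))) := by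
  obtain ⟨P, d, hP, hD⟩ := hJC.diagonalizable
  replace hD : D = diagConj P d := hD
  subst hD
  have hA := hJC.eq_add
  have hc : Commute (diagConj P d) N := hJC.commute
  have hN := hJC.nilpotent
  have hd : ∀ i, ∃ j, h j = (d i).re := by
    intro i
    have hmem : (d i).re ∈ eigenvalueRealParts A := by
      refine ⟨d i, ?_, rfl⟩
      rw [hA]
      exact hasEigenvalue_add_of_commute_nilpotent hc hN
        (Module.End.hasEigenvalue_of_hasEigenvector (hasEigenvector_colVec hP d i))
    rwa [← h_range] at hmem
  subst hA
  have hii : ∀ (j : Fin k) (x : EuclideanSpace ℂ (Fin m)),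
      x ∈ specSpace (diagConj P d) h j.succ → x ∉ specSpace (diagConj P d) h j.castSucc →
      Tendsto (fun t : ℝ => ‖Matrix.toEuclideanLin
        (NormedSpace.exp (t • (diagConj P d + N))) x‖ ^ (1 / t)) atTop (𝓝 (Real.exp (h j))) :=
    fun j x hx hx' => tendsto_norm_exp_apply_rpow hP hc hN h_mono hd hx hx'
  have hcA : Commute (diagConj P d) (diagConj P d + N) := (Commute.refl _).add_right hc
  refine ⟨tendsto_absPow_exp hP hc hN h_mono hd, fun j x hx => ?_, fun j s _ x hx => ?_⟩
  · rw [matrixRan_specProj, matrixRan_specProj]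
    refine ⟨fun hxj => hii j x hxj.1 hxj.2, fun hlim => ?_⟩
    obtain ⟨i, hi, hi'⟩ := exists_mem_layer hP h_mono.monotone hd hx
    have hij := tendsto_nhds_unique (hii i x hi hi') hlim
    obtain rfl := h_mono.injective (Real.exp_injective hij)
    exact ⟨hi, hi'⟩
  · rw [matrixRan_specProj, matrixRan_specProj] at hx ⊢
    have hexp : ∀ t : ℝ, Commute (diagConj P d) (NormedSpace.exp (t • (diagConj P d + N))) :=
      fun t => commute_exp_smul hcA t
    refine ⟨apply_mem_specSpace_of_commute (hexp s) h hx.1, fun hmem => hx.2 ?_⟩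
    -- If the image fell into the lower step, `e^{-sA}`, which preserves that step, would bring `x`
    -- back into it.
    have := apply_mem_specSpace_of_commute (hexp (-s)) h hmem
    rwa [← toEuclideanLin_mul_apply, exp_neg_smul_mul_exp_smul, toEuclideanLin_one_apply] at this
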